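/- Let $\mu$ be the quarter Cantor measure, i.e. the unique Borel probability measure on $\mathbb R$ with $\mu(E)=\tfrac12\left(\mu(\tau_0^{-1}E)+\mu(\tau_2^{-1}E)\right)$ for all Borel sets $E\subseteq\mathbb R$, where $\tau_0(x)=x/4$ and $\tau_2(x)=(x+2)/4$. For $\lambda\in\mathbb R$ let $e_\lambda(x)=e^{2\pi i\lambda x}$. A set $\Gamma\subseteq\mathbb R$ is called a spectrum of $\mu$ if the family $(e_\lambda)_{\lambda\in\Gamma}$ is an orthonormal basis of $L^2(\mu)$. Let $$\Gamma_0=\left\{\sum_{k=0}^n 4^k l_k : l_k\in\{0,1\},\ n\in\mathbb N\right\}.$$ An odd natural number $m$ is called complete if $m\Gamma_0$ is a spectrum of $\mu$, and incomplete otherwise. An odd natural number $m$ is called primitive if $m$ is incomplete and every divisor $d$ of $m$ with $d\neq m$ is complete. **Theorem 1.10.** There are infinitely many primitive numbers. -/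

import Mathlib

open MeasureTheory
open scoped ENNReal

noncomputable section

namespace QuarterCantor

/-- The branch `τ_d(x) = (x + d) / 4` of the iterated function system; the system of the quarter
Cantor set consists of `τ_0` and `τ_2`. -/
def branch (d x : ℝ) : ℝ := (x + d) / 4

/-- `μ` satisfies `μ(E) = (μ(τ_0⁻¹ E) + μ(τ_2⁻¹ E)) / 2` for all Borel sets `E ⊆ ℝ`. -/
def IsInvariant (μ : Measure ℝ) : Prop :=
  ∀ E : Set ℝ, MeasurableSet E →
    μ E = 2⁻¹ * (μ (branch 0 ⁻¹' E) + μ (branch 2 ⁻¹' E))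

/-- The fair coin on `Bool`. -/
def coin : Measure Bool := (2⁻¹ : ℝ≥0∞) • (Measure.dirac false + Measure.dirac true)

instance : IsProbabilityMeasure coin where
  measure_univ := by
    simp only [coin, Measure.smul_apply, Measure.add_apply, measure_univ, smul_eq_mul,
      one_add_one_eq_two]
    exact ENNReal.inv_mul_cancel (by simp) (by simp)

/-- The base four digit (`0` or `2`) encoded by a bit. -/
def digit (b : Bool) : ℝ := if b then 2 else 0

/-- The point `∑_{k ≥ 1} 4^{-k} b_k` with base four digits `b_k ∈ {0, 2}`. -/
def point (ω : ℕ → Bool) : ℝ := ∑' k : ℕ, digit (ω k) / 4 ^ (k + 1)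

/-- The quarter Cantor measure: the law of `∑_{k ≥ 1} 4^{-k} b_k`, where the digits `b_k` are
independent and uniformly distributed on `{0, 2}`. By `isInvariant_iff_eq_cantorMeasure` below it is the
unique invariant Borel probability measure of the system `τ_0, τ_2`. -/
def cantorMeasure : Measure ℝ :=
  (Measure.infinitePi fun _ : ℕ => coin).map point

theorem summable_point (ω : ℕ → Bool) : Summable fun k : ℕ => digit (ω k) / 4 ^ (k + 1) := by
  have h : Summable fun k : ℕ => 2 * ((1 : ℝ) / 4) ^ k :=
    (summable_geometric_of_lt_one (by norm_num) (by norm_num)).mul_left 2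
  refine Summable.of_nonneg_of_le (fun k => ?_) (fun k => ?_) h
  · unfold digit; split_ifs <;> positivity
  · have h4 : (0 : ℝ) < 4 ^ k := by positivity
    have : 2 * ((1 : ℝ) / 4) ^ k = 2 / 4 ^ k := by rw [one_div, inv_pow]; rfl
    rw [this]
    unfold digit
    split_ifs
    · gcongr
      · norm_num
      · omega
    · rw [zero_div]; positivity

theorem measurable_point : Measurable point := by
  unfold point
  refine Measurable.tsum fun k => ?_
  exact ((measurable_of_countable digit).comp (measurable_pi_apply k)).div_const _

instance : IsProbabilityMeasure cantorMeasure :=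
  Measure.isProbabilityMeasure_map measurable_point.aemeasurable

/-- Prepend a bit to a sequence of bits. -/
def cons (b : Bool) (ω : ℕ → Bool) : ℕ → Bool
  | 0 => b
  | k + 1 => ω k

theorem measurable_cons (b : Bool) : Measurable (cons b) := by
  refine measurable_pi_iff.2 fun k => ?_
  cases k with
  | zero => exact measurable_const
  | succ k => exact measurable_pi_apply k

theorem point_cons (b : Bool) (ω : ℕ → Bool) : point (cons b ω) = branch (digit b) (point ω) := by
  unfold point branch
  rw [(summable_point (cons b ω)).tsum_eq_zero_add]
  simp only [cons]
  have : ∀ k : ℕ, digit (ω k) / 4 ^ (k + 1 + 1) = digit (ω k) / 4 ^ (k + 1) / 4 := fun k => by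
    rw [pow_succ _ (k + 1), div_div]
  simp_rw [this]
  rw [tsum_div_const]
  ring

theorem infinitePi_coin :
    (2⁻¹ : ℝ≥0∞) • ((Measure.infinitePi fun _ : ℕ => coin).map (cons false) +
      (Measure.infinitePi fun _ : ℕ => coin).map (cons true)) =
      Measure.infinitePi fun _ : ℕ => coin := by
  classical
  refine Measure.eq_infinitePi _ fun s t ht => ?_
  obtain ⟨N, hN⟩ : ∃ N, s ⊆ Finset.range (N + 1) := by
    obtain ⟨N, hN⟩ := s.exists_nat_subset_range
    exact ⟨N, hN.trans (Finset.range_mono (Nat.le_succ N))⟩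
  set u : ℕ → Set Bool := fun i => if i ∈ s then t i else Set.univ with hu
  have hum : ∀ i, MeasurableSet (u i) := fun i => by
    simp only [hu]; split_ifs; exacts [ht i, MeasurableSet.univ]
  have h1 : Set.pi (s : Set ℕ) t = Set.pi (Finset.range (N + 1) : Set ℕ) u := by
    ext ω
    simp only [Set.mem_pi, Finset.mem_coe, hu]
    constructor
    · intro h i _
      by_cases hi : i ∈ s <;> simp [hi, h i]
    · intro h i hi
      simpa [hi] using h i (hN hi)
  have h2 : ∏ i ∈ s, coin (t i) = ∏ i ∈ Finset.range (N + 1), coin (u i) := by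
    rw [← Finset.prod_subset hN]
    · exact Finset.prod_congr rfl fun i hi => by simp [hu, hi]
    · intro i _ hi; simp only [hu, hi, if_false]; exact measure_univ
  have hpre : ∀ b, (Measure.infinitePi fun _ : ℕ => coin)
      (cons b ⁻¹' Set.pi (Finset.range (N + 1) : Set ℕ) u) =
      Measure.dirac b (u 0) * ∏ i ∈ Finset.range N, coin (u (i + 1)) := by
    intro b
    rw [Measure.dirac_apply' _ (hum 0)]
    have hset : cons b ⁻¹' Set.pi (Finset.range (N + 1) : Set ℕ) u =
        {ω | b ∈ u 0 ∧ ω ∈ Set.pi (Finset.range N : Set ℕ) fun i => u (i + 1)} := by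
      ext ω
      simp only [Set.mem_preimage, Set.mem_pi, Finset.mem_coe, Finset.mem_range, Set.mem_ofPred_eq]
      constructor
      · intro h
        exact ⟨h 0 (by omega), fun i hi => h (i + 1) (by omega)⟩
      · rintro ⟨h0, h⟩ i hi
        cases i with
        | zero => exact h0
        | succ i => exact h i (by omega)
    rw [hset]
    by_cases hb : b ∈ u 0
    · simp only [hb, true_and, Set.ofPred_mem_eq, Set.indicator_of_mem, Pi.one_apply, one_mul]
      exact Measure.infinitePi_pi _ fun i _ => hum (i + 1)
    · simp [hb]
  rw [h1, h2, Measure.smul_apply, Measure.add_apply,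
    Measure.map_apply (measurable_cons _) (.pi (Finset.countable_toSet _) fun i _ => hum i),
    Measure.map_apply (measurable_cons _) (.pi (Finset.countable_toSet _) fun i _ => hum i),
    hpre, hpre, Finset.prod_range_succ', ← add_mul, smul_eq_mul, ← mul_assoc, mul_comm]
  rfl

theorem isInvariant_cantorMeasure : IsInvariant cantorMeasure := by
  intro E hE
  have hm : ∀ d, Measurable (branch d) := fun d => by unfold branch; fun_prop
  have hd : ∀ b, cons b ⁻¹' (point ⁻¹' E) = point ⁻¹' (branch (digit b) ⁻¹' E) := fun b => by
    ext ω; simp [point_cons]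
  unfold cantorMeasure
  rw [Measure.map_apply measurable_point hE, Measure.map_apply measurable_point (hm _ hE),
    Measure.map_apply measurable_point (hm _ hE)]
  conv_lhs => rw [← infinitePi_coin]
  rw [Measure.smul_apply, Measure.add_apply,
    Measure.map_apply (measurable_cons _) (measurable_point hE),
    Measure.map_apply (measurable_cons _) (measurable_point hE), hd, hd]
  simp [digit]

theorem charFun_of_isInvariant {μ : Measure ℝ} [IsProbabilityMeasure μ] (h : IsInvariant μ)
    (t : ℝ) : charFun μ t =
      (1 + Complex.exp (t / 2 * Complex.I)) / 2 * charFun μ (t / 4) := by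
  have hm : ∀ d, Measurable (branch d) := fun d => by unfold branch; fun_prop
  have hμ : μ = (2⁻¹ : ℝ≥0∞) • (μ.map (branch 0) + μ.map (branch 2)) := by
    ext E hE
    rw [Measure.smul_apply, Measure.add_apply, Measure.map_apply (hm _) hE,
      Measure.map_apply (hm _) hE]
    exact h E hE
  have hp : ∀ d, IsProbabilityMeasure (μ.map (branch d)) := fun d =>
    Measure.isProbabilityMeasure_map (hm d).aemeasurable
  have hint : ∀ ν : Measure ℝ, IsProbabilityMeasure ν →
      Integrable (fun x : ℝ => Complex.exp (t * x * Complex.I)) ν := fun ν _ => by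
    refine Integrable.of_bound (C := 1) (by fun_prop) (Filter.Eventually.of_forall fun x => ?_)
    rw [← Complex.ofReal_mul, Complex.norm_exp_ofReal_mul_I]
  have hbr : ∀ d : ℝ, ∫ x, Complex.exp (t * x * Complex.I) ∂(μ.map (branch d)) =
      Complex.exp (t * d / 4 * Complex.I) * charFun μ (t / 4) := fun d => by
    rw [integral_map (hm d).aemeasurable (by fun_prop), charFun_apply_real, ← integral_const_mul]
    refine integral_congr_ae (Filter.Eventually.of_forall fun x => ?_)
    simp only [branch]
    rw [← Complex.exp_add]
    congr 1
    push_cast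
    ring
  rw [charFun_apply_real]
  conv_lhs => rw [hμ]
  rw [integral_smul_measure, integral_add_measure (hint _ (hp 0)) (hint _ (hp 2)), hbr, hbr]
  have he : (t : ℂ) * ((2 : ℝ) : ℂ) / 4 * Complex.I = t / 2 * Complex.I := by
    push_cast; ring
  rw [he]
  simp
  ring

/-- The quarter Cantor measure is the unique invariant Borel probability measure. -/
theorem isInvariant_iff_eq_cantorMeasure (μ : Measure ℝ) :
    (IsProbabilityMeasure μ ∧ IsInvariant μ) ↔ μ = cantorMeasure := by
  constructor
  · rintro ⟨hp, hi⟩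
    refine Measure.ext_of_charFun (funext fun t => ?_)
    have hc := fun s => charFun_of_isInvariant isInvariant_cantorMeasure s
    have hm := fun s => charFun_of_isInvariant hi s
    set D : ℝ → ℝ := fun s => ‖charFun μ s - charFun cantorMeasure s‖ with hD
    have hstep : ∀ s, D s ≤ D (s / 4) := fun s => by
      simp only [hD]
      rw [hc s, hm s, ← mul_sub, norm_mul]
      refine mul_le_of_le_one_left (norm_nonneg _) ?_
      rw [norm_div, Complex.norm_ofNat, div_le_one (by norm_num)]
      refine (norm_add_le _ _).trans ?_
      have : ((s : ℂ) / 2 * Complex.I) = ((s / 2 : ℝ) : ℂ) * Complex.I := by push_cast; ring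
      rw [this, Complex.norm_exp_ofReal_mul_I, norm_one]
      norm_num
    have hn : ∀ n : ℕ, D t ≤ D (t / 4 ^ n) := fun n => by
      induction n with
      | zero => simp
      | succ n ih =>
        refine ih.trans ((hstep _).trans_eq ?_)
        rw [div_div, ← pow_succ]
    have hcont : Continuous D :=
      ((continuous_charFun (μ := μ)).sub (continuous_charFun (μ := cantorMeasure))).norm
    have hlim : Filter.Tendsto (fun n : ℕ => t / 4 ^ n) Filter.atTop (nhds 0) :=
      Filter.Tendsto.const_div_atTop (tendsto_pow_atTop_atTop_of_one_lt (by norm_num)) t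
    have h0 : D t ≤ D 0 := ge_of_tendsto ((hcont.tendsto 0).comp hlim)
      (Filter.Eventually.of_forall hn)
    have : D 0 = 0 := by simp [hD]
    rw [this] at h0
    exact sub_eq_zero.1 (norm_le_zero_iff.1 h0)
  · rintro rfl
    exact ⟨inferInstance, isInvariant_cantorMeasure⟩

/-- The exponential function `e_lam(x) = e^{2πi lam x}`. -/
def expFun (lam x : ℝ) : ℂ := Complex.exp (2 * Real.pi * Complex.I * lam * x)

theorem memLp_expFun (μ : Measure ℝ) [IsFiniteMeasure μ] (lam : ℝ) :
    MemLp (expFun lam) 2 μ := by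
  refine MemLp.of_bound (C := 1) ?_ (Filter.Eventually.of_forall fun x => ?_)
  · unfold expFun
    fun_prop
  · have : 2 * (Real.pi : ℂ) * Complex.I * lam * x =
        ((2 * Real.pi * lam * x : ℝ) : ℂ) * Complex.I := by push_cast; ring
    rw [expFun, this, Complex.norm_exp_ofReal_mul_I]

/-- The class of `e_lam` in `L²(μ)`. -/
def expLp (μ : Measure ℝ) [IsFiniteMeasure μ] (lam : ℝ) : Lp ℂ 2 μ :=
  (memLp_expFun μ lam).toLp (expFun lam)

/-- `Γ ⊆ ℝ` is a spectrum for `μ` if the exponentials `e_lam`, `lam ∈ Γ`, form an orthonormal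
(Hilbert) basis of `L²(μ)`. -/
def IsSpectrum (μ : Measure ℝ) [IsFiniteMeasure μ] (Γ : Set ℝ) : Prop :=
  ∃ b : HilbertBasis Γ ℂ (Lp ℂ 2 μ), ∀ lam : Γ, b lam = expLp μ lam

/-- `Γ₀ = {∑_{k=0}^n 4^k l_k : l_k ∈ {0, 1}, n ∈ ℕ}`. -/
def gammaZero : Set ℝ :=
  {x | ∃ (n : ℕ) (l : ℕ → ℝ), (∀ k, l k = 0 ∨ l k = 1) ∧
    x = ∑ k ∈ Finset.range (n + 1), 4 ^ k * l k}

/-- `Γ(m) = m Γ₀`. -/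
def gamma (m : ℕ) : Set ℝ := (fun x : ℝ => m * x) '' gammaZero

/-- `m` is complete if `Γ(m)` is a spectrum for the quarter Cantor measure (this notion is only
used for odd `m`). -/
def IsComplete (m : ℕ) : Prop := IsSpectrum cantorMeasure (gamma m)

/-- `m` is primitive if it is odd and incomplete and all its proper divisors are complete. -/
def IsPrimitive (m : ℕ) : Prop :=
  Odd m ∧ ¬ IsComplete m ∧ ∀ d : ℕ, d ∣ m → d ≠ m → IsComplete d

end QuarterCantor

end

/-! For a prime `p > 3` let `m = repunit p = (4 ^ p - 1) / 3`. Suppose a set of positive integers is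
such that each member `x` has a successor `y` in the set with `4 * y = x` or `4 * y = x + m`.
Reading base-four digits along successors shows that `x + m * γ` is a power of 4 times an odd number
for every `γ ∈ Γ₀`. The Fourier transform of the Cantor measure vanishes there, so `e_{-x}` is
orthogonal to all of `mΓ₀` and `m` is incomplete (`not_isComplete_of_cycle`). An explicit cycle
through 7 does this for repunits (`not_isComplete_repunit`).

An incomplete odd number has a primitive divisor, obtained by passing to a minimal incomplete
divisor. It is not 1, because 1 is complete (`isComplete_one`, by equality in Bessel's inequality
for every exponential). Repunits of distinct primes greater than 3 are coprime, since `gcd (4 ^ p -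
1) (4 ^ q - 1) = 3`. Distinct primes therefore yield distinct primitive numbers. -/

namespace QuarterCantor

/-! ### Arithmetic of base-four integers with digits 0 and 1 -/

/-- The integer obtained by reading the binary digits of `k` in base four. -/
def spread (k : ℕ) : ℕ := Nat.ofDigits 4 (Nat.digits 2 k)

@[simp]
theorem spread_zero : spread 0 = 0 := by simp [spread]

theorem spread_eq (k : ℕ) : spread k = k % 2 + 4 * spread (k / 2) := by
  rcases Nat.eq_zero_or_pos k with rfl | hk
  · simp
  · rw [spread, Nat.digits_def' (by norm_num) hk, Nat.ofDigits_cons, spread]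

theorem spread_two_mul (k : ℕ) : spread (2 * k) = 4 * spread k := by
  rw [spread_eq]; simp

theorem spread_two_mul_add_one (k : ℕ) : spread (2 * k + 1) = 1 + 4 * spread k := by
  rw [spread_eq]
  have h1 : (2 * k + 1) % 2 = 1 := by omega
  have h2 : (2 * k + 1) / 2 = k := by omega
  rw [h1, h2]

/-- The extreme case has all digits 1, with sum `(4 ^ n - 1) / 3`. The resulting bound 1/3 after
division by `4 ^ n` feeds the domination argument in `tsum_power`. -/
theorem three_mul_spread_lt {n k : ℕ} (h : k < 2 ^ n) : 3 * spread k < 4 ^ n := by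
  induction n generalizing k with
  | zero =>
    obtain rfl : k = 0 := by simpa using h
    simp
  | succ n ih =>
    have := ih (k := k / 2) (by rw [pow_succ] at h; omega)
    rw [spread_eq, pow_succ]
    omega

/-- Integers of the form `4 ^ j * u` with `u` odd; these are integer zeros of the Fourier transform
of the quarter Cantor measure. -/
def IsFourPowMulOdd (z : ℤ) : Prop := ∃ (j : ℕ) (u : ℤ), Odd u ∧ z = 4 ^ j * u

theorem IsFourPowMulOdd.of_odd {z : ℤ} (h : Odd z) : IsFourPowMulOdd z := ⟨0, z, h, by simp⟩

theorem IsFourPowMulOdd.four_mul {z : ℤ} (h : IsFourPowMulOdd z) : IsFourPowMulOdd (4 * z) := by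
  obtain ⟨j, u, hu, rfl⟩ := h
  exact ⟨j + 1, u, hu, by ring⟩

/-- Equal lowest digits cancel and leave a factor 4; at the lowest position where the digits differ,
the difference is odd. -/
theorem isFourPowMulOdd_spread_sub {k l : ℕ} (h : k ≠ l) :
    IsFourPowMulOdd ((spread l : ℤ) - spread k) := by
  induction hN : k + l using Nat.strong_induction_on generalizing k l with
  | _ N ih =>
    by_cases hp : k % 2 = l % 2
    · have := (ih (k / 2 + l / 2) (by omega) (k := k / 2) (l := l / 2) (by omega) rfl).four_mul
      rw [spread_eq l, spread_eq k, hp]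
      convert! this using 1
      push_cast
      ring
    · apply IsFourPowMulOdd.of_odd
      rw [spread_eq l, spread_eq k, Int.odd_iff]
      omega

/-- If the last digit of `k` agrees with the branch taken from `x` to `y`, a factor 4 splits off and
`y` replaces `x`; otherwise the sum is odd. Positivity of `x` makes `x + m * k` drop strictly, so
the first alternative cannot persist. -/
theorem isFourPowMulOdd_of_cycle {m : ℕ} (hm : Odd m) {C : Set ℕ}
    (hC : ∀ x ∈ C, 0 < x ∧ ∃ y ∈ C, 4 * y = x ∨ 4 * y = x + m) {x : ℕ} (hx : x ∈ C) (k : ℕ) :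
    IsFourPowMulOdd ((x : ℤ) + m * spread k) := by
  induction hN : x + m * k using Nat.strong_induction_on generalizing x k with
  | _ N ih =>
    obtain ⟨hx0, y, hy, hxy⟩ := hC x hx
    have hspread := spread_eq k
    have hm0 : 0 < m := hm.pos
    have hkm : m * (k % 2) + 2 * (m * (k / 2)) = m * k := by
      conv_rhs => rw [← Nat.mod_add_div k 2]
      ring
    have hxm : (x : ℤ) + m * spread k = x + m * (k % 2 : ℕ) + 4 * (m * spread (k / 2)) := by
      rw [hspread]
      push_cast
      ring
    rw [hxm]
    rcases Nat.mod_two_eq_zero_or_one k with hk | hk <;> rw [hk] at hkm ⊢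
    · rcases hxy with hxy | hxy
      · have := (ih (y + m * (k / 2)) (by omega) hy (k / 2) rfl).four_mul
        convert! this using 1
        rw [← hxy]
        push_cast
        ring
      · apply IsFourPowMulOdd.of_odd
        rw [Int.odd_iff]
        have := Nat.odd_iff.1 hm
        push_cast
        omega
    · rcases hxy with hxy | hxy
      · apply IsFourPowMulOdd.of_odd
        rw [Int.odd_iff]
        have := Nat.odd_iff.1 hm
        push_cast
        omega
      · have := (ih (y + m * (k / 2)) (by omega) hy (k / 2) rfl).four_mul
        convert! this using 1
        have : (4 * y : ℤ) = x + m := by exact_mod_cast hxy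
        push_cast
        linarith

theorem mem_gammaZero_iff {x : ℝ} : x ∈ gammaZero ↔ ∃ k : ℕ, x = spread k := by
  constructor
  · rintro ⟨n, l, hl, rfl⟩
    -- Allowing an empty sum gives the induction a trivial base case.
    generalize n + 1 = n
    induction n generalizing l with
    | zero => exact ⟨0, by simp⟩
    | succ n ih =>
      obtain ⟨k, hk⟩ := ih (fun i => l (i + 1)) fun i => hl (i + 1)
      have hs : ∑ i ∈ Finset.range (n + 1), (4 : ℝ) ^ i * l i = l 0 + 4 * spread k := by
        rw [← hk, Finset.sum_range_succ', Finset.mul_sum, add_comm]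
        congr 1
        · simp
        · exact Finset.sum_congr rfl fun i _ => by ring
      rcases hl 0 with h0 | h0
      · exact ⟨2 * k, by rw [hs, h0, spread_two_mul]; push_cast; ring⟩
      · exact ⟨2 * k + 1, by rw [hs, h0, spread_two_mul_add_one]; push_cast; ring⟩
  · rintro ⟨k, rfl⟩
    induction k using Nat.strong_induction_on with
    | _ k ih =>
      rcases Nat.eq_zero_or_pos k with rfl | hk
      · exact ⟨0, fun _ => 0, fun _ => Or.inl rfl, by simp⟩
      · obtain ⟨n, l, hl, hs⟩ := ih (k / 2) (by omega)
        refine ⟨n + 1, fun i => Nat.casesOn i ((k % 2 : ℕ) : ℝ) l, fun i => ?_, ?_⟩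
        · cases i with
          | zero => rcases Nat.mod_two_eq_zero_or_one k with h | h <;> simp [h]
          | succ i => exact hl i
        · rw [spread_eq, Nat.cast_add, Nat.cast_mul, hs,
            Finset.sum_range_succ' _ (n + 1), Finset.mul_sum, add_comm]
          congr 1
          · exact Finset.sum_congr rfl fun i _ => by push_cast; ring
          · simp

theorem mem_gamma_iff {m : ℕ} {x : ℝ} : x ∈ gamma m ↔ ∃ k : ℕ, x = m * spread k := by
  simp only [gamma, Set.mem_image, mem_gammaZero_iff]
  constructor
  · rintro ⟨_, ⟨k, rfl⟩, rfl⟩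
    exact ⟨k, rfl⟩
  · rintro ⟨k, rfl⟩
    exact ⟨_, ⟨k, rfl⟩, rfl⟩

/-! ### Exponentials in `L²` and Bessel equality -/

/-- A function whose Fourier transform against a finite measure vanishes is almost everywhere
zero. -/
theorem ae_eq_zero_of_integral_exp_mul_eq_zero {μ : Measure ℝ} [IsFiniteMeasure μ] {g : ℝ → ℝ}
    (hg : Integrable g μ) (h : ∀ t : ℝ, ∫ x, Complex.exp (t * x * Complex.I) * (g x : ℂ) ∂μ = 0) :
    g =ᵐ[μ] 0 := by
  have hfin : ∀ {u : ℝ → ℝ}, Integrable u μ →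
      IsFiniteMeasure (μ.withDensity fun x => ENNReal.ofReal (u x)) := fun hu =>
    isFiniteMeasure_withDensity_ofReal hu.2
  have hchar : ∀ {u : ℝ → ℝ}, Integrable u μ → ∀ t : ℝ,
      charFun (μ.withDensity fun x => ENNReal.ofReal (u x)) t =
        ∫ x, Complex.exp (t * x * Complex.I) * ((max (u x) 0 : ℝ) : ℂ) ∂μ := by
    intro u hu t
    rw [charFun_apply_real, integral_withDensity_eq_integral_toReal_smul₀
      hu.aemeasurable.ennreal_ofReal (Filter.Eventually.of_forall fun _ => ENNReal.ofReal_lt_top)]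
    refine integral_congr_ae (Filter.Eventually.of_forall fun x => ?_)
    simp only [ENNReal.toReal_ofReal', Complex.real_smul]
    exact mul_comm _ _
  have hint : ∀ {u : ℝ → ℝ}, Integrable u μ → ∀ t : ℝ,
      Integrable (fun x : ℝ => Complex.exp (t * x * Complex.I) * ((max (u x) 0 : ℝ) : ℂ)) μ := by
    intro u hu t
    refine Integrable.bdd_mul (c := 1) hu.pos_part.ofReal (by fun_prop)
      (Filter.Eventually.of_forall fun x => ?_)
    rw [← Complex.ofReal_mul, Complex.norm_exp_ofReal_mul_I]
  have := hfin hg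
  have := hfin hg.neg
  -- `ENNReal.ofReal` truncates at 0, so these densities are the positive and negative parts of `g`;
  -- the hypothesis says their transforms agree.
  have heq : (μ.withDensity fun x => ENNReal.ofReal (g x)) =
      μ.withDensity fun x => ENNReal.ofReal ((-g) x) := by
    refine Measure.ext_of_charFun (funext fun t => ?_)
    rw [hchar hg, hchar hg.neg, ← sub_eq_zero, ← integral_sub (hint hg t) (hint hg.neg t), ← h t]
    refine integral_congr_ae (Filter.Eventually.of_forall fun x => ?_)
    simp only [Pi.neg_apply]
    rw [← mul_sub, ← Complex.ofReal_sub]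
    congr 2
    rcases le_total (g x) 0 with hx | hx
    · rw [max_eq_right hx, max_eq_left (by linarith)]; ring
    · rw [max_eq_left hx, max_eq_right (by linarith)]; ring
  rw [withDensity_eq_iff hg.aemeasurable.ennreal_ofReal hg.neg.aemeasurable.ennreal_ofReal
    hg.lintegral_lt_top.ne] at heq
  filter_upwards [heq] with x hx
  simp only [Pi.neg_apply, Pi.zero_apply] at hx ⊢
  rcases lt_trichotomy (g x) 0 with h0 | h0 | h0
  · rw [ENNReal.ofReal_of_nonpos h0.le, eq_comm, ENNReal.ofReal_eq_zero] at hx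
    linarith
  · exact h0
  · rw [ENNReal.ofReal_of_nonpos (by linarith : -g x ≤ 0), ENNReal.ofReal_eq_zero] at hx
    linarith

theorem inner_expLp (μ : Measure ℝ) [IsFiniteMeasure μ] (lam : ℝ) (f : Lp ℂ 2 μ) :
    inner ℂ (expLp μ lam) f =
      ∫ x, Complex.exp (((-(2 * Real.pi * lam) : ℝ) : ℂ) * x * Complex.I) * f x ∂μ := by
  rw [L2.inner_def]
  refine integral_congr_ae ?_
  filter_upwards [(memLp_expFun μ lam).coeFn_toLp] with x hx
  rw [expLp, hx, RCLike.inner_apply, expFun, ← Complex.exp_conj, mul_comm]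
  congr 2
  simp only [map_mul, Complex.conj_ofReal, Complex.conj_I, Complex.conj_ofNat]
  push_cast
  ring

theorem inner_expLp_expLp (μ : Measure ℝ) [IsFiniteMeasure μ] (a b : ℝ) :
    inner ℂ (expLp μ a) (expLp μ b) = charFun μ (2 * Real.pi * (b - a)) := by
  rw [inner_expLp, charFun_apply_real]
  refine integral_congr_ae ?_
  filter_upwards [(memLp_expFun μ b).coeFn_toLp] with x hx
  rw [expLp, hx, expFun, ← Complex.exp_add]
  congr 1
  push_cast
  ring

/-- The exponentials are total in `L²(μ)`. -/
theorem eq_zero_of_forall_inner_expLp_eq_zero {μ : Measure ℝ} [IsFiniteMeasure μ] {f : Lp ℂ 2 μ}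
    (h : ∀ lam : ℝ, inner ℂ (expLp μ lam) f = 0) : f = 0 := by
  have hf : Integrable f μ := (Lp.memLp f).integrable (by norm_num)
  have hmul : ∀ {u : ℝ → ℂ}, Integrable u μ → ∀ t : ℝ,
      Integrable (fun x : ℝ => Complex.exp (t * x * Complex.I) * u x) μ := by
    intro u hu t
    refine Integrable.bdd_mul (c := 1) hu (by fun_prop) (Filter.Eventually.of_forall fun x => ?_)
    rw [← Complex.ofReal_mul, Complex.norm_exp_ofReal_mul_I]
  have h1 : ∀ t : ℝ, ∫ x, Complex.exp (t * x * Complex.I) * f x ∂μ = 0 := by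
    intro t
    have := h (-(t / (2 * Real.pi)))
    rw [inner_expLp] at this
    convert! this using 6
    field_simp
  have hconj : Integrable (fun x => (starRingEnd ℂ) (f x)) μ :=
    hf.congr' (by
      exact Complex.continuous_conj.comp_aestronglyMeasurable hf.1)
      (Filter.Eventually.of_forall fun x => by simp)
  -- Conjugation turns the transform at `-t` into that of the conjugate at `t`; the real and
  -- imaginary parts can then be treated separately.
  have h2 : ∀ t : ℝ, ∫ x, Complex.exp (t * x * Complex.I) * (starRingEnd ℂ) (f x) ∂μ = 0 := by
    intro t
    have := congrArg (starRingEnd ℂ) (h1 (-t))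
    rw [← integral_conj, map_zero] at this
    rw [← this]
    refine integral_congr_ae (Filter.Eventually.of_forall fun x => ?_)
    simp [← Complex.exp_conj]
  have hre : (fun x => (f x).re) =ᵐ[μ] 0 := by
    refine ae_eq_zero_of_integral_exp_mul_eq_zero hf.re fun t => ?_
    have := integral_add (hmul hf t) (hmul hconj t)
    rw [h1, h2, add_zero] at this
    rw [← mul_eq_zero_iff_left (two_ne_zero (α := ℂ)), ← integral_const_mul, ← this]
    refine integral_congr_ae (Filter.Eventually.of_forall fun x => ?_)
    simp only
    rw [← mul_add, Complex.add_conj]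
    push_cast
    ring
  have him : (fun x => (f x).im) =ᵐ[μ] 0 := by
    refine ae_eq_zero_of_integral_exp_mul_eq_zero hf.im fun t => ?_
    have := integral_sub (hmul hf t) (hmul hconj t)
    rw [h1, h2, sub_zero] at this
    rw [← mul_eq_zero_iff_left (mul_ne_zero (two_ne_zero (α := ℂ)) Complex.I_ne_zero),
      ← integral_const_mul, ← this]
    refine integral_congr_ae (Filter.Eventually.of_forall fun x => ?_)
    simp only
    rw [← mul_sub, Complex.sub_conj]
    push_cast
    ring
  refine Lp.eq_zero_iff_ae_eq_zero.2 ?_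
  filter_upwards [hre, him] with x h1 h2
  exact Complex.ext h1 h2

/-- If a vector attains equality in Bessel's inequality, it is orthogonal to whatever is orthogonal
to the orthonormal sequence. -/
theorem inner_eq_zero_of_bessel_eq {E : Type*} [NormedAddCommGroup E] [InnerProductSpace ℂ E]
    {v : ℕ → E} (hv : Orthonormal ℂ v) {e f : E} (he : ∑' k, ‖inner ℂ (v k) e‖ ^ 2 = ‖e‖ ^ 2)
    (hf : ∀ k, inner ℂ (v k) f = 0) : inner ℂ e f = 0 := by
  rcases eq_or_ne f 0 with rfl | hf0
  · simp
  have hf0' : (‖f‖ : ℂ) ≠ 0 := by simpa using hf0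
  set w : ℕ → E := fun n => Nat.casesOn n ((‖f‖ : ℂ)⁻¹ • f) v with hw
  have hwo : Orthonormal ℂ w := by
    refine ⟨fun n => ?_, fun i j hij => ?_⟩
    · cases n with
      | zero => simpa [hw, norm_smul] using inv_mul_cancel₀ (norm_ne_zero_iff.2 hf0)
      | succ n => exact hv.1 n
    · cases i with
      | zero =>
        cases j with
        | zero => exact absurd rfl hij
        | succ j => simp [hw, inner_smul_left, inner_eq_zero_symm.1 (hf j)]
      | succ i =>
        cases j with
        | zero => simp [hw, inner_smul_right, hf i]
        | succ j => exact hv.2 fun h => hij (by rw [h])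
  have hb := hwo.tsum_inner_products_le e
  rw [(hwo.inner_products_summable e).tsum_eq_zero_add] at hb
  have hsum : ∑' k, ‖inner ℂ (w (k + 1)) e‖ ^ 2 = ‖e‖ ^ 2 := he
  have h0 : ‖inner ℂ (w 0) e‖ ^ 2 = 0 := le_antisymm (by linarith) (by positivity)
  have h1 : inner ℂ ((‖f‖ : ℂ)⁻¹ • f) e = 0 := by simpa [hw] using h0
  rw [inner_smul_left, mul_eq_zero] at h1
  refine inner_eq_zero_symm.1 (h1.resolve_left ?_)
  simpa using hf0

/-! ### Completeness of 1 -/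

/-- The squared modulus of the Fourier transform of the quarter Cantor measure. -/
noncomputable def power (t : ℝ) : ℝ := ‖charFun cantorMeasure (2 * Real.pi * t)‖ ^ 2

theorem power_zero : power 0 = 1 := by simp [power]

theorem continuous_power : Continuous power := by
  unfold power
  have := continuous_charFun (μ := cantorMeasure)
  fun_prop

theorem power_eq (t : ℝ) : power t = Real.cos (Real.pi * t / 2) ^ 2 * power (t / 4) := by
  have h1 : 1 + Complex.exp ((2 * Real.pi * t : ℝ) / 2 * Complex.I) =
      Complex.exp ((Real.pi * t / 2 : ℝ) * Complex.I) *
        (2 * (Real.cos (Real.pi * t / 2) : ℂ)) := by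
    rw [Complex.ofReal_cos, Complex.two_cos, mul_add, ← Complex.exp_add, ← Complex.exp_add, add_comm]
    congr 1
    · congr 1; push_cast; ring
    · rw [← Complex.exp_zero]; congr 1; ring
  rw [power, power, charFun_of_isInvariant isInvariant_cantorMeasure, h1, norm_mul, norm_div,
    norm_mul, norm_mul, Complex.norm_exp_ofReal_mul_I, Complex.norm_real, mul_pow,
    mul_div_assoc (2 * Real.pi)]
  simp

/-- The squared modulus of the Fourier transform of the `n`-th approximation of the quarter Cantor
measure. -/
noncomputable def approxPower : ℕ → ℝ → ℝ
  | 0, _ => 1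
  | n + 1, t => Real.cos (Real.pi * t / 2) ^ 2 * approxPower n (t / 4)

theorem approxPower_nonneg (n : ℕ) (t : ℝ) : 0 ≤ approxPower n t := by
  induction n generalizing t with
  | zero => exact zero_le_one
  | succ n ih => exact mul_nonneg (sq_nonneg _) (ih _)

theorem power_eq_approxPower_mul (n : ℕ) (t : ℝ) :
    power t = approxPower n t * power (t / 4 ^ n) := by
  induction n generalizing t with
  | zero => simp [approxPower]
  | succ n ih =>
    rw [power_eq, ih, approxPower, mul_assoc, div_div, ← pow_succ']

theorem sum_range_two_mul (N : ℕ) (F : ℕ → ℝ) :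
    ∑ k ∈ Finset.range (2 * N), F k = ∑ k ∈ Finset.range N, (F (2 * k) + F (2 * k + 1)) := by
  induction N with
  | zero => simp
  | succ N ih =>
    rw [mul_add, mul_one, Finset.sum_range_succ, Finset.sum_range_succ, ih, Finset.sum_range_succ,
      add_assoc]

/-- Even and odd `k` separate the last digit. Adding 1 to `t` turns the cosine into a sine up to
sign, so the two halves contribute `cos² + sin² = 1`. -/
theorem sum_approxPower (n : ℕ) (t : ℝ) :
    ∑ k ∈ Finset.range (2 ^ n), approxPower n (t + spread k) = 1 := by
  induction n generalizing t with
  | zero => simp [approxPower]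
  | succ n ih =>
    rw [pow_succ', sum_range_two_mul, Finset.sum_add_distrib]
    have h0 : ∀ k, approxPower (n + 1) (t + spread (2 * k)) =
        Real.cos (Real.pi * t / 2) ^ 2 * approxPower n (t / 4 + spread k) := by
      intro k
      rw [approxPower, spread_two_mul]
      congr 2
      · have : Real.pi * (t + (4 * spread k : ℕ)) / 2 =
            Real.pi * t / 2 + spread k * (2 * Real.pi) := by push_cast; ring
        rw [this, Real.cos_add_nat_mul_two_pi]
      · push_cast; ring
    have h1 : ∀ k, approxPower (n + 1) (t + spread (2 * k + 1)) =
        Real.sin (Real.pi * t / 2) ^ 2 * approxPower n ((t + 1) / 4 + spread k) := by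
      intro k
      rw [approxPower, spread_two_mul_add_one]
      congr 1
      · have : Real.pi * (t + (1 + 4 * spread k : ℕ)) / 2 =
            Real.pi * t / 2 + Real.pi / 2 + spread k * (2 * Real.pi) := by push_cast; ring
        rw [this, Real.cos_add_nat_mul_two_pi, Real.cos_add_pi_div_two, neg_sq]
      · congr 1; push_cast; ring
    simp only [h0, h1, ← Finset.mul_sum, ih, mul_one, Real.cos_sq_add_sin_sq]

theorem tendsto_div_four_pow (t : ℝ) :
    Filter.Tendsto (fun n : ℕ => t / 4 ^ n) Filter.atTop (nhds 0) :=
  Filter.Tendsto.const_div_atTop (tendsto_pow_atTop_atTop_of_one_lt (by norm_num)) t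

theorem tendsto_power_div_four_pow (t : ℝ) :
    Filter.Tendsto (fun n : ℕ => power (t / 4 ^ n)) Filter.atTop (nhds 1) := by
  rw [← power_zero]
  exact (continuous_power.tendsto 0).comp (tendsto_div_four_pow t)

/-- On this interval every cosine factor is positive, and the remaining tail of the product tends to
1. -/
theorem power_pos {t : ℝ} (ht : |t| ≤ 1 / 2) : 0 < power t := by
  have hpos : ∀ n (s : ℝ), |s| ≤ 1 / 2 → 0 < approxPower n s := by
    intro n
    induction n with
    | zero => exact fun _ _ => zero_lt_one
    | succ n ih =>
      intro s hs
      have hs' := abs_le.1 hs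
      refine mul_pos (pow_pos (Real.cos_pos_of_mem_Ioo ⟨?_, ?_⟩) 2) (ih _ ?_)
      · nlinarith [Real.pi_pos]
      · nlinarith [Real.pi_pos]
      · rw [abs_le]; constructor <;> linarith
  obtain ⟨n, hn⟩ := ((tendsto_power_div_four_pow t).eventually (lt_mem_nhds one_pos)).exists
  rw [power_eq_approxPower_mul n]
  exact mul_pos (hpos n t ht) hn

theorem exists_le_power : ∃ δ > 0, ∀ t : ℝ, |t| ≤ 1 / 2 → δ ≤ power t := by
  obtain ⟨x, hx, hmin⟩ := (isCompact_Icc (a := (-(1 / 2) : ℝ)) (b := 1 / 2)).exists_isMinOn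
    ⟨0, by norm_num⟩ continuous_power.continuousOn
  exact ⟨power x, power_pos (abs_le.2 hx), fun t ht => hmin (abs_le.1 ht)⟩

theorem charFun_eq_zero {z : ℤ} (hz : IsFourPowMulOdd z) :
    charFun cantorMeasure (2 * Real.pi * z) = 0 := by
  suffices power z = 0 by simpa [power] using this
  obtain ⟨j, u, hu, rfl⟩ := hz
  induction j with
  | zero =>
    obtain ⟨r, rfl⟩ := hu
    have : Real.pi * ((4 ^ 0 * (2 * r + 1) : ℤ) : ℝ) / 2 = (2 * r + 1) * Real.pi / 2 := by
      push_cast; ring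
    rw [power_eq, this, Real.cos_eq_zero_iff.2 ⟨r, rfl⟩]
    simp
  | succ j ih =>
    have : ((4 ^ (j + 1) * u : ℤ) : ℝ) / 4 = ((4 ^ j * u : ℤ) : ℝ) := by
      push_cast; ring
    rw [power_eq, this, ih, mul_zero]

theorem norm_expLp (lam : ℝ) : ‖expLp cantorMeasure lam‖ = 1 := by
  have h' : ‖expLp cantorMeasure lam‖ ^ 2 = 1 := by
    rw [← inner_self_eq_norm_sq (𝕜 := ℂ), inner_expLp_expLp, sub_self, mul_zero, charFun_zero]
    simp
  nlinarith [norm_nonneg (expLp cantorMeasure lam)]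

theorem orthonormal_expLp_spread :
    Orthonormal ℂ fun k : ℕ => expLp cantorMeasure (spread k) := by
  refine ⟨fun k => norm_expLp _, fun k l hkl => ?_⟩
  dsimp only
  rw [inner_expLp_expLp]
  have := charFun_eq_zero (isFourPowMulOdd_spread_sub hkl)
  push_cast at this
  exact this

theorem norm_inner_expLp_sq (a b : ℝ) :
    ‖inner ℂ (expLp cantorMeasure a) (expLp cantorMeasure b)‖ ^ 2 = power (-b + a) := by
  rw [inner_expLp_expLp, power, show 2 * Real.pi * (b - a) = -(2 * Real.pi * (-b + a)) by ring,
    charFun_neg, RCLike.norm_conj]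

/-- This is the limit of the finite identity `sum_approxPower` by dominated convergence; Bessel's
inequality supplies the summable majorant. -/
theorem tsum_power (t : ℝ) : ∑' k, power (t + spread k) = 1 := by
  obtain ⟨δ, hδ, hle⟩ := exists_le_power
  have hsum : Summable fun k => power (t + spread k) := by
    refine (orthonormal_expLp_spread.inner_products_summable (expLp cantorMeasure (-t))).congr
      fun k => ?_
    rw [norm_inner_expLp_sq, neg_neg]
  have hlim := tendsto_tsum_of_dominated_convergence (𝓕 := Filter.atTop)
    (f := fun (n k : ℕ) => if k < 2 ^ n then approxPower n (t + spread k) else 0)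
    (g := fun k => power (t + spread k)) (bound := fun k => δ⁻¹ * power (t + spread k))
    (hsum.mul_left _) ?_ ?_
  · refine tendsto_nhds_unique hlim (tendsto_const_nhds.congr fun n => ?_)
    rw [tsum_eq_sum (s := Finset.range (2 ^ n)), ← sum_approxPower n t]
    · exact Finset.sum_congr rfl fun k hk => by rw [if_pos (Finset.mem_range.1 hk)]
    · exact fun k hk => if_neg (by simpa using hk)
  · intro k
    have h1 := (tendsto_const_nhds (x := power (t + spread k))).div
      (tendsto_power_div_four_pow (t + spread k)) one_ne_zero
    rw [div_one] at h1
    refine h1.congr' ?_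
    filter_upwards [(tendsto_power_div_four_pow (t + spread k)).eventually (lt_mem_nhds one_pos),
      Filter.eventually_ge_atTop k] with n hn hk
    rw [if_pos (hk.trans_lt Nat.lt_two_pow_self), Pi.div_apply,
      power_eq_approxPower_mul n (t + spread k), mul_div_cancel_right₀ _ hn.ne']
  -- Since `1/6 + 1/3 = 1/2`, the argument `(t + spread k) / 4 ^ n` stays where `power` is at least
  -- `δ`, so dividing by that tail costs at most a factor `δ⁻¹`.
  · have hsmall : ∀ᶠ n : ℕ in Filter.atTop, |t / 4 ^ n| < 1 / 6 := by
      have := (tendsto_div_four_pow t).abs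
      rw [abs_zero] at this
      exact this.eventually (gt_mem_nhds (by norm_num))
    filter_upwards [hsmall] with n hn k
    split_ifs with hk
    · rw [Real.norm_of_nonneg (approxPower_nonneg _ _), power_eq_approxPower_mul n (t + spread k)]
      have h4 : (0 : ℝ) < 4 ^ n := by positivity
      have h3 : (spread k : ℝ) / 4 ^ n < 1 / 3 := by
        rw [div_lt_iff₀ h4]
        have : (3 * spread k : ℝ) < 4 ^ n := by exact_mod_cast three_mul_spread_lt hk
        linarith
      have h0 : 0 ≤ (spread k : ℝ) / 4 ^ n := by positivity
      have := hle ((t + spread k) / 4 ^ n) (by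
        rw [add_div]
        rw [abs_lt] at hn
        rw [abs_le]
        constructor <;> linarith)
      rw [inv_mul_eq_div, le_div_iff₀ hδ]
      exact mul_le_mul_of_nonneg_left this (approxPower_nonneg _ _)
    · rw [norm_zero]
      have : 0 ≤ power (t + spread k) := sq_nonneg _
      positivity

theorem isComplete_one : IsComplete 1 := by
  have htot : ∀ f : Lp ℂ 2 cantorMeasure,
      (∀ k, inner ℂ (expLp cantorMeasure (spread k)) f = 0) → f = 0 := by
    intro f hf
    refine eq_zero_of_forall_inner_expLp_eq_zero fun lam => ?_
    refine inner_eq_zero_of_bessel_eq orthonormal_expLp_spread ?_ hf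
    rw [norm_expLp, one_pow, ← tsum_power (-lam)]
    exact tsum_congr fun k => norm_inner_expLp_sq _ _
  have hmem : ∀ lam : gamma 1, ∃ k : ℕ, (lam : ℝ) = spread k := fun lam => by
    simpa using mem_gamma_iff.1 lam.2
  choose idx hidx using hmem
  have hv : Orthonormal ℂ fun lam : gamma 1 => expLp cantorMeasure lam := by
    have := orthonormal_expLp_spread.comp idx fun a b hab => Subtype.ext (by rw [hidx, hidx, hab])
    convert! this using 2 with lam
    simp [hidx lam]
  refine ⟨HilbertBasis.mkOfOrthogonalEqBot hv ?_, fun lam => by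
    rw [HilbertBasis.coe_mkOfOrthogonalEqBot]⟩
  rw [Submodule.eq_bot_iff]
  intro f hf
  refine htot f fun k => ?_
  exact (Submodule.mem_orthogonal _ _).1 hf _
    (Submodule.subset_span ⟨⟨spread k, mem_gamma_iff.2 ⟨k, by simp⟩⟩, rfl⟩)

/-! ### Cycles obstruct completeness -/

/-- For `x` in the cycle, `e_{-x}` is orthogonal to a family with dense span, hence zero, although
its norm is 1. -/
theorem not_isComplete_of_cycle {m : ℕ} (hm : Odd m) {C : Set ℕ} (hne : C.Nonempty)
    (hC : ∀ x ∈ C, 0 < x ∧ ∃ y ∈ C, 4 * y = x ∨ 4 * y = x + m) : ¬ IsComplete m := by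
  rintro ⟨b, hb⟩
  obtain ⟨x, hx⟩ := hne
  have hzero : expLp cantorMeasure (-(x : ℝ)) = 0 := by
    have : Submodule.span ℂ (Set.range b) ≤ (ℂ ∙ expLp cantorMeasure (-(x : ℝ)))ᗮ := by
      rw [Submodule.span_le]
      rintro _ ⟨lam, rfl⟩
      obtain ⟨k, hk⟩ := mem_gamma_iff.1 lam.2
      rw [SetLike.mem_coe, Submodule.mem_orthogonal_singleton_iff_inner_right, hb,
        inner_expLp_expLp, hk]
      have := charFun_eq_zero (isFourPowMulOdd_of_cycle hm hC hx k)
      rw [← this]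
      congr 1
      push_cast
      ring
    have h2 := Submodule.topologicalClosure_mono this
    rw [b.dense_span, (Submodule.isClosed_orthogonal _).submodule_topologicalClosure_eq] at h2
    exact inner_self_eq_zero.1 (Submodule.mem_orthogonal_singleton_iff_inner_right.1
      (h2 (Submodule.mem_top (x := expLp cantorMeasure (-(x : ℝ))))))
  have := norm_expLp (-(x : ℝ))
  rw [hzero, norm_zero] at this
  exact zero_ne_one this

/-! ### Repunits and their primitive divisors -/

/-- The base four repunit `1 + 4 + ⋯ + 4 ^ (p - 1)`. -/
def repunit (p : ℕ) : ℕ := ∑ i ∈ Finset.range p, 4 ^ i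

theorem three_mul_repunit_add_one (p : ℕ) : 3 * repunit p + 1 = 4 ^ p := by
  induction p with
  | zero => rfl
  | succ p ih =>
    rw [repunit, Finset.sum_range_succ, ← repunit, pow_succ]
    omega

theorem repunit_succ (p : ℕ) : repunit (p + 1) = 4 * repunit p + 1 := by
  have h1 := three_mul_repunit_add_one p
  have h2 := three_mul_repunit_add_one (p + 1)
  rw [pow_succ] at h2
  omega

theorem odd_repunit_succ (p : ℕ) : Odd (repunit (p + 1)) :=
  ⟨2 * repunit p, by rw [repunit_succ]; ring⟩

theorem not_isComplete_repunit (n : ℕ) : ¬ IsComplete (repunit (n + 3)) := by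
  have hq := three_mul_repunit_add_one n
  have hm : repunit (n + 3) = 64 * repunit n + 21 := by
    simp only [repunit_succ]
    ring
  -- With `r = repunit n`, `m = 64 * r + 21` and `4 ^ n = 3 * r + 1`, three steps `(x + m) / 4` lead
  -- from 7 through `7 + 16 * r` and `7 + 20 * r` to `7 * 4 ^ n`; then `n` divisions by 4 return to
  -- 7.
  refine not_isComplete_of_cycle (odd_repunit_succ _)
    (C := {x | (∃ k ≤ n, x = 7 * 4 ^ k) ∨ x = 7 + 16 * repunit n ∨ x = 7 + 20 * repunit n})
    ⟨7, Or.inl ⟨0, Nat.zero_le _, rfl⟩⟩ ?_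
  rintro x (⟨k, hk, rfl⟩ | rfl | rfl)
  · refine ⟨by positivity, ?_⟩
    cases k with
    | zero => exact ⟨_, Or.inr (Or.inl rfl), Or.inr (by omega)⟩
    | succ k => exact ⟨7 * 4 ^ k, Or.inl ⟨k, by omega, rfl⟩, Or.inl (by ring)⟩
  · exact ⟨by omega, _, Or.inr (Or.inr rfl), Or.inr (by omega)⟩
  · exact ⟨by omega, 7 * 4 ^ n, Or.inl ⟨n, le_rfl, rfl⟩, Or.inr (by omega)⟩

theorem repunit_mod_three (p : ℕ) : repunit p % 3 = p % 3 := by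
  induction p with
  | zero => rfl
  | succ p ih => rw [repunit_succ]; omega

theorem eq_of_dvd_repunit {p q d : ℕ} (hp : p.Prime) (hq : q.Prime) (h3 : p ≠ 3) (hd : d ≠ 1)
    (hdp : d ∣ repunit p) (hdq : d ∣ repunit q) : p = q := by
  by_contra hne
  have hsub : ∀ r, repunit r ∣ 4 ^ r - 1 := fun r =>
    ⟨3, by have := three_mul_repunit_add_one r; omega⟩
  have hd3 : d ∣ 3 := by
    have := Nat.dvd_gcd (hdp.trans (hsub p)) (hdq.trans (hsub q))
    rwa [Nat.pow_sub_one_gcd_pow_sub_one, (Nat.coprime_primes hp hq).2 hne] at this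
  obtain rfl := ((Nat.dvd_prime Nat.prime_three).1 hd3).resolve_left hd
  have : 3 ∣ p :=
    -- As 4 is 1 modulo 3, the repunit of length `p` is congruent to `p`.
    Nat.dvd_of_mod_eq_zero (by rw [← repunit_mod_three]; exact Nat.mod_eq_zero_of_dvd hdp)
  exact h3 ((Nat.prime_dvd_prime_iff_eq Nat.prime_three hp).1 this).symm

theorem exists_isPrimitive_dvd {m : ℕ} (hm : Odd m) (h : ¬ IsComplete m) :
    ∃ d, d ∣ m ∧ IsPrimitive d := by
  induction m using Nat.strong_induction_on with
  | _ m ih =>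
    by_cases hall : ∀ d, d ∣ m → d ≠ m → IsComplete d
    · exact ⟨m, dvd_rfl, hm, h, hall⟩
    · push Not at hall
      obtain ⟨d, hdm, hne, hd⟩ := hall
      obtain ⟨e, hed, he⟩ :=
        ih d (lt_of_le_of_ne (Nat.le_of_dvd hm.pos hdm) hne) (hm.of_dvd_nat hdm) hd
      exact ⟨e, hed.trans hdm, he⟩

end QuarterCantor

theorem theorem1p10 : {m : ℕ | QuarterCantor.IsPrimitive m}.Infinite := by
  have hex : ∀ p : {p : ℕ | p.Prime ∧ 3 < p}, ∃ d, d ∣ QuarterCantor.repunit p ∧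
      QuarterCantor.IsPrimitive d := by
    rintro ⟨p, hp, h3⟩
    obtain ⟨n, rfl⟩ : ∃ n, p = n + 3 := ⟨p - 3, by omega⟩
    exact QuarterCantor.exists_isPrimitive_dvd (QuarterCantor.odd_repunit_succ _)
      (QuarterCantor.not_isComplete_repunit n)
  choose d hdvd hd using hex
  have : Infinite {p : ℕ | p.Prime ∧ 3 < p} :=
    Set.infinite_coe_iff.2 (Set.infinite_of_not_bddAbove fun ⟨N, hN⟩ => by
      obtain ⟨p, hp, hpr⟩ := Nat.exists_infinite_primes (N + 4)
      have := hN ⟨hpr, by omega⟩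
      omega)
  refine Set.infinite_of_injective_forall_mem (f := d) (fun p q hpq => Subtype.ext ?_) hd
  refine QuarterCantor.eq_of_dvd_repunit p.2.1 q.2.1 p.2.2.ne' ?_ (hdvd p) (hpq ▸ hdvd q)
  -- A primitive number is incomplete, so it cannot be 1; this is where completeness of 1 enters.
  intro h1
  exact (hd p).2.1 (h1 ▸ QuarterCantor.isComplete_one)
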